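/- For every $n\ge 1$ let $x_0,\dots,x_{n-1}$ be independent random variables, each uniformly distributed on $\{-1,1\}$ (they may depend on $n$ and live on a probability space depending on $n$). For $j\ge 1$ put $$s_j=\sqrt{\tfrac2n}\sum_{k=0}^{n-1}x_k\sin\Big(\frac{2\pi kj}{n}\Big),\qquad c_j=\sqrt{\tfrac2n}\sum_{k=0}^{n-1}x_k\cos\Big(\frac{2\pi kj}{n}\Big),$$ $$|f_j|=\sqrt{\Big(\sum_{k=0}^{n-1}x_k\cos\Big(\frac{2\pi kj}{n}\Big)\Big)^2+\Big(\sum_{k=0}^{n-1}x_k\sin\Big(\frac{2\pi kj}{n}\Big)\Big)^2},\qquad m=\frac n2 .$$ Let $R$ be a fixed positive integer. Then, as $n\to\infty$: (1) the random vector $(s_1,\dots,s_R,c_1,\dots,c_R)$ converges in distribution to a vector of $2R$ independent standard normal random variables; (2) the random vector $\big(\tfrac1m|f_1|^2,\dots,\tfrac1m|f_R|^2\big)$ converges in distribution to a vector of $R$ independent random variables, each with the $\chi^2$-distribution with $2$ degrees of freedom (the law of the sum of the squares of two independent standard normal variables); and this limit law has the joint probability density $$(y_1,\dots,y_R)\longmapsto\frac1{2^R}\exp\Big(-\frac12\sum_{j=1}^R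 y_j\Big)\quad (y_1,\dots,y_R\ge 0),\qquad 0\text{ otherwise},$$ which at $y_j=\tfrac1m|f_j|^2$ equals $\frac1{2^R}\exp\big(-\sum_{j=1}^R|f_j|^2/(2m)\big)$. -/

import Mathlib

open MeasureTheory ProbabilityTheory Filter Topology

namespace DFTTest

noncomputable section

/-- The uniform distribution on `{-1, 1}`, as a measure on `ℝ`. -/
def uniformSign : Measure ℝ :=
  (2⁻¹ : ENNReal) • Measure.dirac (1 : ℝ) + (2⁻¹ : ENNReal) • Measure.dirac (-1 : ℝ)

/-- The sine sum `∑_{k<n} x_k sin (2πkj/n)`. -/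
def sinSum {n : ℕ} (x : Fin n → ℝ) (j : ℕ) : ℝ :=
  ∑ k : Fin n, x k * Real.sin (2 * Real.pi * (k : ℝ) * (j : ℝ) / (n : ℝ))

/-- The cosine sum `∑_{k<n} x_k cos (2πkj/n)`. -/
def cosSum {n : ℕ} (x : Fin n → ℝ) (j : ℕ) : ℝ :=
  ∑ k : Fin n, x k * Real.cos (2 * Real.pi * (k : ℝ) * (j : ℝ) / (n : ℝ))

/-- The modulus `|f_j|` of the `j`-th discrete Fourier coefficient of `x_0, …, x_{n-1}`. -/
def fourierAbs {n : ℕ} (x : Fin n → ℝ) (j : ℕ) : ℝ :=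
  Real.sqrt (cosSum x j ^ 2 + sinSum x j ^ 2)

/-- The normalized sine coefficient `s_j = √(2/n) ∑_{k<n} x_k sin (2πkj/n)`. -/
def sCoeff {n : ℕ} (x : Fin n → ℝ) (j : ℕ) : ℝ :=
  Real.sqrt (2 / (n : ℝ)) * sinSum x j

/-- The normalized cosine coefficient `c_j = √(2/n) ∑_{k<n} x_k cos (2πkj/n)`. -/
def cCoeff {n : ℕ} (x : Fin n → ℝ) (j : ℕ) : ℝ :=
  Real.sqrt (2 / (n : ℝ)) * cosSum x j

/-- The `χ²`-distribution with `d` degrees of freedom: the law of the sum of the squares of `d`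
independent standard normal variables. -/
def chiSquared (d : ℕ) : Measure ℝ :=
  (Measure.pi fun _ : Fin d => gaussianReal 0 1).map fun z => ∑ i, z i ^ 2

instance isProbabilityMeasure_chiSquared (d : ℕ) : IsProbabilityMeasure (chiSquared d) :=
  Measure.isProbabilityMeasure_map
    (Measurable.aemeasurable (by fun_prop))

/-- The function `2^{-R} exp (-(y_1 + ⋯ + y_R)/2)` on `[0, ∞)^R`, and `0` elsewhere. -/
def limitDensity (R : ℕ) (y : Fin R → ℝ) : ENNReal :=
  open Classical in
  if ∀ j, 0 ≤ y j then ENNReal.ofReal (1 / 2 ^ R * Real.exp (-(∑ j, y j) / 2)) else 0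

end

end DFTTest

namespace DFTTest

/-! Each `s_j` and `c_j` is a weighted sum of independent signs, so the joint characteristic
function at `t` is exactly `∏ k, cos (a k)` with `a k = ∑ i, t i * w i k`. The weights are at most
`√(2/n)`, so each cosine may be replaced by `exp (-a k ^ 2 / 2)`, and only `∑ k, a k ^ 2` matters in
the limit (`tendsto_prod_cos`). For `n > 2R` the weight vectors are orthonormal
(`sum_fourierWeight_mul`), so this sum is `∑ i, t i ^ 2`, and Lévy's continuity theorem gives the
Gaussian limit. The second limit follows by continuous mapping, as `|f_j|²/m = s_j² + c_j²`; polar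
coordinates give the density of `χ²₂`. -/

lemma abs_prod_sub_prod_le {ι : Type*} (s : Finset ι) (f g : ι → ℝ)
    (hf : ∀ i ∈ s, |f i| ≤ 1) (hg : ∀ i ∈ s, |g i| ≤ 1) :
    |∏ i ∈ s, f i - ∏ i ∈ s, g i| ≤ ∑ i ∈ s, |f i - g i| := by
  classical
  induction s using Finset.induction_on with
  | empty => simp
  | insert a s ha ih =>
    rw [Finset.prod_insert ha, Finset.prod_insert ha, Finset.sum_insert ha]
    have ih' := ih (fun i hi => hf i (Finset.mem_insert_of_mem hi))
      (fun i hi => hg i (Finset.mem_insert_of_mem hi))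
    have hF : |∏ i ∈ s, f i| ≤ 1 := by
      rw [Finset.abs_prod]
      exact Finset.prod_le_one (fun _ _ => abs_nonneg _)
        fun i hi => hf i (Finset.mem_insert_of_mem hi)
    have hga := hg a (Finset.mem_insert_self a s)
    calc |f a * ∏ i ∈ s, f i - g a * ∏ i ∈ s, g i|
        = |(f a - g a) * ∏ i ∈ s, f i + g a * (∏ i ∈ s, f i - ∏ i ∈ s, g i)| := by
          congr 1; ring
      _ ≤ |f a - g a| * |∏ i ∈ s, f i| + |g a| * |∏ i ∈ s, f i - ∏ i ∈ s, g i| := by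
          rw [← abs_mul, ← abs_mul]; exact abs_add_le _ _
      _ ≤ |f a - g a| * 1 + 1 * |∏ i ∈ s, f i - ∏ i ∈ s, g i| := by gcongr
      _ ≤ _ := by linarith

/-- Both functions equal `1 - u²/2` up to a multiple of `u⁴`, and the two constants add up to less
than 1. -/
lemma abs_cos_sub_exp_le {u : ℝ} (hu : |u| ≤ 1) :
    |Real.cos u - Real.exp (-u ^ 2 / 2)| ≤ u ^ 4 := by
  have h1 := Real.cos_bound hu
  have hu2 : u ^ 2 ≤ 1 := by rw [← sq_abs]; exact pow_le_one₀ (abs_nonneg _) hu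
  have h2 := Real.abs_exp_sub_one_sub_id_le (x := -u ^ 2 / 2)
    (by rw [abs_le]; constructor <;> nlinarith [sq_nonneg u])
  have h4 : |u| ^ 4 = u ^ 4 := by rw [← abs_pow]; exact abs_of_nonneg (by positivity)
  have h5 : 0 ≤ u ^ 4 := by positivity
  have h6 : (-u ^ 2 / 2) ^ 2 = u ^ 4 / 4 := by ring
  rw [h4] at h1
  rw [h6] at h2
  rw [abs_le] at *
  constructor <;> linarith [h1.1, h1.2, h2.1, h2.2]

/-- A product of cosines of uniformly small angles is asymptotically determined by the sum of the
squares of the angles. -/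
lemma tendsto_prod_cos {a : (n : ℕ) → Fin n → ℝ} {ε : ℕ → ℝ} {v : ℝ}
    (hε : Tendsto ε atTop (𝓝 0)) (ha : ∀ n k, |a n k| ≤ ε n)
    (hv : Tendsto (fun n => ∑ k, a n k ^ 2) atTop (𝓝 v)) :
    Tendsto (fun n => ∏ k, Real.cos (a n k)) atTop (𝓝 (Real.exp (-v / 2))) := by
  have hexp : Tendsto (fun n => ∏ k, Real.exp (-(a n k) ^ 2 / 2)) atTop
      (𝓝 (Real.exp (-v / 2))) := by
    have : ∀ n, ∏ k, Real.exp (-(a n k) ^ 2 / 2) = Real.exp (-(∑ k, a n k ^ 2) / 2) := fun n => by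
      rw [← Real.exp_sum, ← Finset.sum_div, Finset.sum_neg_distrib]
    simp_rw [this]
    exact (Real.continuous_exp.tendsto _).comp (hv.neg.div_const 2)
  have hdiff : Tendsto (fun n => ∏ k, Real.cos (a n k) - ∏ k, Real.exp (-(a n k) ^ 2 / 2)) atTop
      (𝓝 0) := by
    -- The total error is at most `∑ a⁴ ≤ ε² ∑ a²`, and the last sum converges.
    have hb : Tendsto (fun n => ε n ^ 2 * ∑ k, a n k ^ 2) atTop (𝓝 0) := by
      simpa using (hε.pow 2).mul hv
    refine squeeze_zero_norm' ?_ hb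
    filter_upwards [hε.eventually_le_const zero_lt_one] with n hn
    rw [Real.norm_eq_abs]
    refine (abs_prod_sub_prod_le _ _ _ (fun k _ => Real.abs_cos_le_one _) fun k _ => ?_).trans ?_
    · rw [Real.abs_exp, Real.exp_le_one_iff]
      nlinarith [sq_nonneg (a n k)]
    · rw [Finset.mul_sum]
      refine Finset.sum_le_sum fun k _ => (abs_cos_sub_exp_le ((ha n k).trans hn)).trans ?_
      have : a n k ^ 2 ≤ ε n ^ 2 := sq_le_sq' (abs_le.1 (ha n k)).1 (abs_le.1 (ha n k)).2
      nlinarith [sq_nonneg (a n k)]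
  simpa using hdiff.add hexp

/-- The product of measures with integrable densities has the product density. -/
lemma pi_withDensity_ofReal {ι : Type*} [Fintype ι] {α : ι → Type*} [∀ i, MeasurableSpace (α i)]
    (μ : (i : ι) → Measure (α i)) [∀ i, SigmaFinite (μ i)] (g : (i : ι) → α i → ℝ)
    (hg : ∀ i, Integrable (g i) (μ i)) (hg0 : ∀ i x, 0 ≤ g i x) :
    Measure.pi (fun i => (μ i).withDensity fun x => ENNReal.ofReal (g i x)) =
      (Measure.pi μ).withDensity fun x => ENNReal.ofReal (∏ i, g i (x i)) := by
  have (i : ι) : IsFiniteMeasure ((μ i).withDensity fun x => ENNReal.ofReal (g i x)) :=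
    isFiniteMeasure_withDensity_ofReal (hg i).2
  refine Measure.pi_eq fun s hs => ?_
  rw [withDensity_apply _ (MeasurableSet.univ_pi hs), Measure.restrict_pi_pi,
    ← ofReal_integral_eq_lintegral_ofReal, integral_fintype_prod_eq_prod,
    ENNReal.ofReal_prod_of_nonneg]
  · refine Finset.prod_congr rfl fun i _ => ?_
    rw [withDensity_apply _ (hs i), ofReal_integral_eq_lintegral_ofReal (hg i).integrableOn]
    exact ae_of_all _ (hg0 i)
  · exact fun i _ => integral_nonneg (hg0 i)
  · exact Integrable.fintype_prod_dep fun i => (hg i).integrableOn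
  · exact ae_of_all _ fun x => Finset.prod_nonneg fun i _ => hg0 i (x i)

/-! ### Vanishing trigonometric sums. -/

/-- A geometric sum whose ratio `z` satisfies `z ^ n = 1` and `z ≠ 1`. -/
lemma sum_cexp_eq_zero {n : ℕ} {p : ℤ} (hp : ¬ (n : ℤ) ∣ p) :
    ∑ k : Fin n, Complex.exp ((2 * Real.pi * (k : ℝ) * p / n : ℝ) * Complex.I) = 0 := by
  rcases Nat.eq_zero_or_pos n with rfl | hn
  · simp
  have hn0 : (n : ℂ) ≠ 0 := by exact_mod_cast hn.ne'
  set z := Complex.exp (2 * Real.pi * Complex.I * (p / n)) with hz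
  have hterm : ∀ k : ℕ, Complex.exp ((2 * Real.pi * (k : ℝ) * p / n : ℝ) * Complex.I) = z ^ k := by
    intro k
    rw [hz, ← Complex.exp_nat_mul]
    congr 1
    push_cast
    ring
  have hz1 : z ≠ 1 := by
    rw [hz, Ne, Complex.exp_eq_one_iff]
    rintro ⟨m, hm⟩
    apply hp
    refine ⟨m, ?_⟩
    have h2 : (2 * Real.pi * Complex.I : ℂ) ≠ 0 := Complex.two_pi_I_ne_zero
    have : (p / n : ℂ) = m := mul_left_cancel₀ h2 (by rw [hm]; ring)
    rw [div_eq_iff hn0] at this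
    rw [mul_comm]
    exact_mod_cast this
  have hzn : z ^ n = 1 := by
    rw [hz, ← Complex.exp_nat_mul, Complex.exp_eq_one_iff]
    exact ⟨p, by field_simp⟩
  simp_rw [hterm]
  rw [Fin.sum_univ_eq_sum_range (fun k => z ^ k), geom_sum_eq hz1, hzn]
  simp

lemma sum_cos_eq_zero {n : ℕ} {p : ℤ} (hp : ¬ (n : ℤ) ∣ p) :
    ∑ k : Fin n, Real.cos (2 * Real.pi * (k : ℝ) * p / n) = 0 := by
  have := congrArg Complex.re (sum_cexp_eq_zero hp)
  simpa only [Complex.re_sum, Complex.exp_ofReal_mul_I_re, Complex.zero_re] using this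

lemma sum_sin_eq_zero {n : ℕ} {p : ℤ} (hp : ¬ (n : ℤ) ∣ p) :
    ∑ k : Fin n, Real.sin (2 * Real.pi * (k : ℝ) * p / n) = 0 := by
  have := congrArg Complex.im (sum_cexp_eq_zero hp)
  simpa only [Complex.im_sum, Complex.exp_ofReal_mul_I_im, Complex.zero_im] using this

/-! ### Central limit theorem for weighted signs. -/

lemma charFun_uniformSign (t : ℝ) : charFun uniformSign t = Real.cos t := by
  have h2 : (2⁻¹ : ENNReal) ≠ ⊤ := by simp
  rw [charFun_apply_real, uniformSign, integral_add_measure, integral_smul_measure,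
    integral_smul_measure, integral_dirac, integral_dirac, Complex.ofReal_cos, Complex.cos]
  · simp
    ring
  · exact (integrable_dirac (by simp)).smul_measure h2
  · exact (integrable_dirac (by simp)).smul_measure h2

lemma charFun_map_sum_mul_of_uniformSign {Ω : Type*} [MeasurableSpace Ω] {P : Measure Ω}
    {κ : Type*} [Fintype κ] {x : κ → Ω → ℝ} (hlaw : ∀ k, HasLaw (x k) uniformSign P)
    (hindep : iIndepFun x P) (a : κ → ℝ) :
    charFun (P.map fun ω => ∑ k, a k * x k ω) 1 = ∏ k, (Real.cos (a k) : ℂ) := by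
  have hi : iIndepFun (fun k ω => a k * x k ω) P :=
    hindep.comp (fun k y => a k * y) fun k => measurable_const_mul (a k)
  rw [hi.charFun_map_fun_sum_eq_prod fun k => (hlaw k).aemeasurable.const_mul (a k),
    Finset.prod_apply]
  refine Finset.prod_congr rfl fun k _ => ?_
  rw [charFun_map_mul_comp (hlaw k).aemeasurable, (hlaw k).map_eq, charFun_uniformSign, mul_one]

/-- A multivariate central limit theorem for weighted sums of independent uniform signs. -/
theorem tendstoInDistribution_sum_uniformSign {Ω : ℕ → Type*} [∀ n, MeasurableSpace (Ω n)]
    {P : (n : ℕ) → Measure (Ω n)} [∀ n, IsProbabilityMeasure (P n)]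
    {x : (n : ℕ) → Fin n → Ω n → ℝ} (hlaw : ∀ n k, HasLaw (x n k) uniformSign (P n))
    (hindep : ∀ n, iIndepFun (x n) (P n)) {ι : Type*} [Fintype ι] [DecidableEq ι]
    {w : (n : ℕ) → ι → Fin n → ℝ} {ε : ℕ → ℝ} (hε : Tendsto ε atTop (𝓝 0))
    (hw : ∀ n i k, |w n i k| ≤ ε n)
    (horth : ∀ i j, Tendsto (fun n => ∑ k, w n i k * w n j k) atTop (𝓝 (if i = j then 1 else 0))) :
    TendstoInDistribution (fun n ω i => ∑ k, x n k ω * w n i k) atTop (fun z : ι → ℝ => z) P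
      (Measure.pi fun _ => gaussianReal 0 1) := by
  have hmeas : ∀ n, AEMeasurable (fun ω => WithLp.toLp 2 fun i => ∑ k, x n k ω * w n i k) (P n) :=
    fun n => (PiLp.continuous_toLp 2 _).measurable.comp_aemeasurable <| aemeasurable_pi_lambda _
      fun i => Finset.aemeasurable_fun_sum _ fun k _ => (hlaw n k).aemeasurable.mul_const _
  -- The characteristic function uses an inner product, so the vectors are moved to Euclidean space
  -- and brought back by continuous mapping.
  suffices h : TendstoInDistribution
      (fun n ω => WithLp.toLp 2 fun i => ∑ k, x n k ω * w n i k) atTop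
      (fun z : ι → ℝ => WithLp.toLp 2 z) P (Measure.pi fun _ => gaussianReal 0 1) from
    h.continuous_comp (PiLp.continuous_ofLp 2 _)
  refine ⟨hmeas, (PiLp.continuous_toLp 2 _).aemeasurable,
    ProbabilityMeasure.tendsto_iff_tendsto_charFun.2 fun t => ?_⟩
  -- Pairing with `t` leaves one scalar weighted sum of signs, evaluated at frequency 1.
  have hchar : ∀ n, charFun ((P n).map fun ω => WithLp.toLp 2 fun i => ∑ k, x n k ω * w n i k) t =
      ((∏ k, Real.cos (∑ i, t i * w n i k) : ℝ) : ℂ) := by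
    intro n
    rw [Complex.ofReal_prod, ← charFun_map_sum_mul_of_uniformSign (hlaw n) (hindep n), charFun_apply, charFun_apply,
      integral_map (hmeas n) (by fun_prop), integral_map _ (by fun_prop)]
    · refine integral_congr_ae (ae_of_all _ fun ω => ?_)
      have : (inner ℝ (WithLp.toLp 2 fun i => ∑ k, x n k ω * w n i k) t : ℝ) =
          ∑ k, (∑ i, t i * w n i k) * x n k ω := by
        simp only [PiLp.inner_apply, RCLike.inner_apply, conj_trivial, Finset.mul_sum,
          Finset.sum_mul]
        rw [Finset.sum_comm]
        exact Finset.sum_congr rfl fun _ _ => Finset.sum_congr rfl fun _ _ => by ring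
      simp [this]
    · exact Finset.aemeasurable_fun_sum _ fun k _ => (hlaw n k).aemeasurable.const_mul _
  have hlim : charFun ((Measure.pi fun _ : ι => gaussianReal 0 1).map fun z => WithLp.toLp 2 z) t =
      ((Real.exp (-(∑ i, t i ^ 2) / 2) : ℝ) : ℂ) := by
    rw [charFun_pi]
    simp_rw [charFun_gaussianReal]
    rw [← Complex.exp_sum]
    push_cast
    congr 1
    rw [neg_div, Finset.sum_div, ← Finset.sum_neg_distrib]
    exact Finset.sum_congr rfl fun _ _ => by ring
  simp only [ProbabilityMeasure.coe_mk, hchar, hlim]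
  refine (Complex.continuous_ofReal.tendsto _).comp (tendsto_prod_cos
    (ε := fun n => (∑ i, |t i|) * ε n) (by simpa using hε.const_mul _) (fun n k => ?_) ?_)
  · rw [Finset.sum_mul]
    refine (Finset.abs_sum_le_sum_abs _ _).trans (Finset.sum_le_sum fun i _ => ?_)
    rw [abs_mul]
    exact mul_le_mul_of_nonneg_left (hw n i k) (abs_nonneg _)
  · have hsq : ∀ n, ∑ k, (∑ i, t i * w n i k) ^ 2 =
        ∑ i, ∑ j, t i * t j * ∑ k, w n i k * w n j k := by
      intro n
      simp_rw [sq, Finset.sum_mul_sum, Finset.mul_sum]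
      rw [Finset.sum_comm]
      refine Finset.sum_congr rfl fun i _ => ?_
      rw [Finset.sum_comm]
      exact Finset.sum_congr rfl fun _ _ => Finset.sum_congr rfl fun _ _ => by ring
    have hv : ∑ i, t i ^ 2 = ∑ i, ∑ j, t i * t j * (if i = j then (1 : ℝ) else 0) := by
      simp [sq]
    simp_rw [hsq, hv]
    exact tendsto_finsetSum _ fun i _ => tendsto_finsetSum _ fun j _ => (horth i j).const_mul _

/-! ### The `χ²₂` law and its density. -/

lemma chiSquared_two_eq_map_prod :
    chiSquared 2 = ((gaussianReal 0 1).prod (gaussianReal 0 1)).map fun p => p.1 ^ 2 + p.2 ^ 2 := by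
  rw [← (measurePreserving_finTwoArrow (gaussianReal 0 1)).map_eq,
    Measure.map_map (by fun_prop) (by fun_prop), chiSquared]
  congr 1
  ext z
  simp [Fin.sum_univ_two]

/-- Products of `χ²` laws with two degrees of freedom are images of products of Gaussians. -/
lemma map_pi_gaussianReal_eq_pi_chiSquared (ι : Type*) [Fintype ι] :
    (Measure.pi fun _ : ι ⊕ ι => gaussianReal 0 1).map
        (fun z i => z (Sum.inl i) ^ 2 + z (Sum.inr i) ^ 2) =
      Measure.pi fun _ : ι => chiSquared 2 := by
  -- Regroup the coordinates into pairs `(z (inl i), z (inr i))`, preserving the measure.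
  have h1 := measurePreserving_sumPiEquivProdPi (fun _ : ι ⊕ ι => gaussianReal 0 1)
  have h2 := (measurePreserving_arrowProdEquivProdArrow ℝ ℝ ι (fun _ => gaussianReal 0 1)
    (fun _ => gaussianReal 0 1)).symm
  have h3 := (h2.comp h1).map_eq
  simp_rw [chiSquared_two_eq_map_prod]
  rw [← Measure.pi_map_pi (fun _ => by fun_prop), ← h3, Measure.map_map (by fun_prop)
    (by fun_prop)]
  rfl

lemma lintegral_comp_sq_Ioi (h : ℝ → ENNReal) :
    ∫⁻ y in Set.Ioi 0, h y = ∫⁻ r in Set.Ioi 0, ENNReal.ofReal (2 * r) * h (r ^ 2) := by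
  have himg : (fun r : ℝ => r ^ 2) '' Set.Ioi 0 = Set.Ioi 0 := by
    ext y
    constructor
    · rintro ⟨r, hr, rfl⟩
      exact pow_pos (Set.mem_Ioi.1 hr) 2
    · exact fun hy => ⟨√y, Real.sqrt_pos.2 hy, Real.sq_sqrt (le_of_lt hy)⟩
  have hinj : Set.InjOn (fun r : ℝ => r ^ 2) (Set.Ioi 0) := fun a ha b hb hab =>
    (pow_left_inj₀ (le_of_lt ha) (le_of_lt hb) two_ne_zero).1 hab
  rw [← himg, lintegral_image_eq_lintegral_abs_deriv_mul measurableSet_Ioi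
    (f' := fun r => 2 * r) (fun r _ => by simpa using (hasDerivAt_pow 2 r).hasDerivWithinAt) hinj,
    himg]
  refine setLIntegral_congr_fun measurableSet_Ioi fun r hr => ?_
  have : 0 ≤ 2 * r := by linarith [Set.mem_Ioi.1 hr]
  simp only [abs_of_nonneg this]

lemma gaussianPDF_mul_gaussianPDF (a b : ℝ) :
    gaussianPDF 0 1 a * gaussianPDF 0 1 b =
      ENNReal.ofReal ((2 * Real.pi)⁻¹ * Real.exp (-(a ^ 2 + b ^ 2) / 2)) := by
  rw [gaussianPDF, gaussianPDF, ← ENNReal.ofReal_mul (gaussianPDFReal_nonneg _ _ _)]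
  congr 1
  simp only [gaussianPDFReal, NNReal.coe_one, mul_one, sub_zero]
  rw [mul_mul_mul_comm, ← Real.exp_add, ← mul_inv,
    Real.mul_self_sqrt (by positivity)]
  congr 2
  ring

lemma lintegral_gaussianReal_prod_comp_sq_add_sq {f : ℝ → ENNReal} (hf : Measurable f) :
    ∫⁻ p, f (p.1 ^ 2 + p.2 ^ 2) ∂((gaussianReal 0 1).prod (gaussianReal 0 1)) =
      ∫⁻ y in Set.Ioi 0, ENNReal.ofReal (1 / 2 * Real.exp (-y / 2)) * f y := by
  rw [gaussianReal_of_var_ne_zero 0 one_ne_zero,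
    prod_withDensity (measurable_gaussianPDF _ _) (measurable_gaussianPDF _ _),
    lintegral_withDensity_eq_lintegral_mul _ (by fun_prop) (by fun_prop)]
  change ∫⁻ p : ℝ × ℝ, (gaussianPDF 0 1 p.1 * gaussianPDF 0 1 p.2) * f (p.1 ^ 2 + p.2 ^ 2) = _
  simp_rw [gaussianPDF_mul_gaussianPDF]
  rw [← lintegral_comp_polarCoord_symm, lintegral_comp_sq_Ioi]
  have hsq : ∀ p : ℝ × ℝ, (p.1 * Real.cos p.2) ^ 2 + (p.1 * Real.sin p.2) ^ 2 = p.1 ^ 2 :=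
    fun p => by linear_combination p.1 ^ 2 * Real.sin_sq_add_cos_sq p.2
  simp only [polarCoord_symm_apply, hsq, smul_eq_mul]
  rw [polarCoord_target, Measure.volume_eq_prod, setLIntegral_prod _ (by fun_prop)]
  -- The angle contributes `2π`, cancelling the Gaussian constant; the Jacobian `r` is `1/2` times
  -- the `2r` from `y = r²`.
  refine setLIntegral_congr_fun measurableSet_Ioi fun r hr => ?_
  have hr0 : 0 < r := hr
  have hpi := Real.pi_pos
  simp only [setLIntegral_const, Real.volume_Ioo]
  rw [← mul_assoc, ← mul_assoc, mul_right_comm, ← ENNReal.ofReal_mul hr0.le,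
    ← ENNReal.ofReal_mul (by positivity), ← ENNReal.ofReal_mul (by positivity)]
  congr 2
  field_simp
  ring

lemma chiSquared_two_eq_withDensity :
    chiSquared 2 = volume.withDensity fun y => ENNReal.ofReal
      ((Set.Ici 0).indicator (fun y => 1 / 2 * Real.exp (-y / 2)) y) := by
  have hm : Measurable fun y : ℝ => ENNReal.ofReal
      ((Set.Ici 0).indicator (fun y => 1 / 2 * Real.exp (-y / 2)) y) :=
    ((show Measurable fun y : ℝ => 1 / 2 * Real.exp (-y / 2) by fun_prop).indicator
      measurableSet_Ici).ennreal_ofReal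
  refine Measure.ext_of_lintegral _ fun f hf => ?_
  rw [chiSquared_two_eq_map_prod, lintegral_map hf (by fun_prop),
    lintegral_gaussianReal_prod_comp_sq_add_sq hf,
    lintegral_withDensity_eq_lintegral_mul _ hm hf, ← setLIntegral_congr Ioi_ae_eq_Ici.symm,
    ← lintegral_indicator measurableSet_Ici]
  refine lintegral_congr fun y => ?_
  by_cases hy : y ∈ Set.Ici (0 : ℝ) <;> simp [hy]

lemma integrable_indicator_half_exp :
    Integrable ((Set.Ici 0).indicator fun y : ℝ => 1 / 2 * Real.exp (-y / 2)) := by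
  rw [integrable_indicator_iff measurableSet_Ici, integrableOn_Ici_iff_integrableOn_Ioi]
  have h : IntegrableOn (fun y : ℝ => Real.exp (-y / 2)) (Set.Ioi 0) := by
    simpa [div_eq_inv_mul] using integrableOn_exp_mul_Ioi (a := -(1 / 2)) (by norm_num) 0
  exact h.const_mul _

theorem pi_chiSquared_two_eq_withDensity (R : ℕ) :
    (Measure.pi fun _ : Fin R => chiSquared 2) = volume.withDensity (limitDensity R) := by
  rw [chiSquared_two_eq_withDensity,
    pi_withDensity_ofReal (fun _ => volume) (fun _ => _) (fun _ => integrable_indicator_half_exp)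
      (fun _ => Set.indicator_nonneg fun _ _ => by positivity), ← volume_pi]
  congr 1
  ext y
  rw [limitDensity]
  split_ifs with h
  · congr 1
    have : ∀ i, (Set.Ici 0).indicator (fun y : ℝ => 1 / 2 * Real.exp (-y / 2)) (y i) =
        1 / 2 * Real.exp (-y i / 2) := fun i => Set.indicator_of_mem (h i) _
    simp_rw [this]
    rw [Finset.prod_mul_distrib, ← Real.exp_sum, ← Finset.sum_div, Finset.sum_neg_distrib]
    simp
  · push Not at h
    obtain ⟨i, hi⟩ := h
    rw [Finset.prod_eq_zero (Finset.mem_univ i), ENNReal.ofReal_zero]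
    exact Set.indicator_of_notMem (by simpa using hi) _

/-! ### Discrete orthogonality and the Fourier weights. -/

/-- By product-to-sum, only the frequencies `p ± q` occur. As `0 < p + q < n` and `|p - q| < n`, the
only possible multiple of `n` is `p - q = 0`. -/
lemma sum_cos_mul_cos {n p q : ℕ} (hp : 0 < p) (hpq : p + q < n) :
    ∑ k : Fin n, Real.cos (2 * Real.pi * (k : ℝ) * p / n) * Real.cos (2 * Real.pi * (k : ℝ) * q / n)
      = if p = q then (n : ℝ) / 2 else 0 := by
  have hadd : ∑ k : Fin n, Real.cos (2 * Real.pi * (k : ℝ) * ((p + q : ℤ) : ℝ) / n) = 0 :=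
    sum_cos_eq_zero fun h => by have := Int.le_of_dvd (by lia) h; lia
  have hsub : ∑ k : Fin n, Real.cos (2 * Real.pi * (k : ℝ) * ((p - q : ℤ) : ℝ) / n) =
      if p = q then (n : ℝ) else 0 := by
    split_ifs with h
    · simp [h]
    · exact sum_cos_eq_zero fun hd => h <| by
        have := Int.eq_zero_of_abs_lt_dvd hd (by rw [abs_lt]; lia)
        lia
  have hterm : ∀ k : Fin n, Real.cos (2 * Real.pi * (k : ℝ) * p / n) *
      Real.cos (2 * Real.pi * (k : ℝ) * q / n) =
        (Real.cos (2 * Real.pi * (k : ℝ) * ((p - q : ℤ) : ℝ) / n) +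
          Real.cos (2 * Real.pi * (k : ℝ) * ((p + q : ℤ) : ℝ) / n)) / 2 := fun k => by
    push_cast
    rw [mul_sub, mul_add, sub_div, add_div (2 * Real.pi * (k : ℝ) * p), Real.cos_sub, Real.cos_add]
    ring
  rw [Finset.sum_congr rfl fun k _ => hterm k, ← Finset.sum_div, Finset.sum_add_distrib, hadd, hsub]
  split_ifs <;> simp

lemma sum_sin_mul_sin {n p q : ℕ} (hp : 0 < p) (hpq : p + q < n) :
    ∑ k : Fin n, Real.sin (2 * Real.pi * (k : ℝ) * p / n) * Real.sin (2 * Real.pi * (k : ℝ) * q / n)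
      = if p = q then (n : ℝ) / 2 else 0 := by
  have hadd : ∑ k : Fin n, Real.cos (2 * Real.pi * (k : ℝ) * ((p + q : ℤ) : ℝ) / n) = 0 :=
    sum_cos_eq_zero fun h => by have := Int.le_of_dvd (by lia) h; lia
  have hterm : ∀ k : Fin n, Real.sin (2 * Real.pi * (k : ℝ) * p / n) *
      Real.sin (2 * Real.pi * (k : ℝ) * q / n) =
        Real.cos (2 * Real.pi * (k : ℝ) * p / n) * Real.cos (2 * Real.pi * (k : ℝ) * q / n) -
          Real.cos (2 * Real.pi * (k : ℝ) * ((p + q : ℤ) : ℝ) / n) := fun k => by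
    push_cast
    rw [mul_add, add_div, Real.cos_add]
    ring
  rw [Finset.sum_congr rfl fun k _ => hterm k, Finset.sum_sub_distrib, hadd, sum_cos_mul_cos hp hpq,
    sub_zero]

lemma sum_sin_mul_cos {n p q : ℕ} (hp : 0 < p) (hpq : p + q < n) :
    ∑ k : Fin n, Real.sin (2 * Real.pi * (k : ℝ) * p / n) * Real.cos (2 * Real.pi * (k : ℝ) * q / n)
      = 0 := by
  have hadd : ∑ k : Fin n, Real.sin (2 * Real.pi * (k : ℝ) * ((p + q : ℤ) : ℝ) / n) = 0 :=
    sum_sin_eq_zero fun h => by have := Int.le_of_dvd (by lia) h; lia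
  have hsub : ∑ k : Fin n, Real.sin (2 * Real.pi * (k : ℝ) * ((p - q : ℤ) : ℝ) / n) = 0 := by
    by_cases h : p = q
    · simp [h]
    · exact sum_sin_eq_zero fun hd => h <| by
        have := Int.eq_zero_of_abs_lt_dvd hd (by rw [abs_lt]; lia)
        lia
  have hterm : ∀ k : Fin n, Real.sin (2 * Real.pi * (k : ℝ) * p / n) *
      Real.cos (2 * Real.pi * (k : ℝ) * q / n) =
        (Real.sin (2 * Real.pi * (k : ℝ) * ((p - q : ℤ) : ℝ) / n) +
          Real.sin (2 * Real.pi * (k : ℝ) * ((p + q : ℤ) : ℝ) / n)) / 2 := fun k => by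
    push_cast
    rw [mul_sub, mul_add, sub_div, add_div (2 * Real.pi * (k : ℝ) * p), Real.sin_sub, Real.sin_add]
    ring
  rw [Finset.sum_congr rfl fun k _ => hterm k, ← Finset.sum_div, Finset.sum_add_distrib, hadd, hsub]
  simp

/-- The coefficients of `x_0, …, x_{n-1}` in `(s_1, …, s_R, c_1, …, c_R)`. -/
noncomputable def fourierWeight (R n : ℕ) (i : Fin R ⊕ Fin R) (k : Fin n) : ℝ :=
  √(2 / (n : ℝ)) * Sum.elim
    (fun j : Fin R => Real.sin (2 * Real.pi * (k : ℝ) * ((j + 1 : ℕ) : ℝ) / (n : ℝ)))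
    (fun j : Fin R => Real.cos (2 * Real.pi * (k : ℝ) * ((j + 1 : ℕ) : ℝ) / (n : ℝ))) i

lemma abs_fourierWeight_le (R n : ℕ) (i : Fin R ⊕ Fin R) (k : Fin n) :
    |fourierWeight R n i k| ≤ √(2 / (n : ℝ)) := by
  rw [fourierWeight, abs_mul, abs_of_nonneg (Real.sqrt_nonneg _)]
  refine mul_le_of_le_one_right (Real.sqrt_nonneg _) ?_
  cases i
  · exact Real.abs_sin_le_one _
  · exact Real.abs_cos_le_one _

/-- Frequencies lie in `1, …, R`, so two of them add up to at most `2R < n`. -/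
lemma sum_fourierWeight_mul {R n : ℕ} (hn : 2 * R < n) (i j : Fin R ⊕ Fin R) :
    ∑ k, fourierWeight R n i k * fourierWeight R n j k = if i = j then 1 else 0 := by
  have hn0 : (0 : ℝ) < n := by exact_mod_cast (by lia : 0 < n)
  have hfac : ∀ a b : ℝ, (√(2 / (n : ℝ)) * a) * (√(2 / (n : ℝ)) * b) = 2 / n * (a * b) :=
    fun a b => by rw [mul_mul_mul_comm, Real.mul_self_sqrt (by positivity)]
  simp only [fourierWeight, hfac, ← Finset.mul_sum]
  rcases i with i | i <;> rcases j with j | j <;>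
    simp only [Sum.elim_inl, Sum.elim_inr, Sum.inl.injEq, Sum.inr.injEq, reduceCtorEq, if_false]
  · rw [sum_sin_mul_sin (by lia) (by lia)]
    simp only [Nat.add_right_cancel_iff, Fin.val_inj]
    split_ifs
    · field_simp
    · simp
  · rw [sum_sin_mul_cos (by lia) (by lia), mul_zero]
  · simp_rw [mul_comm (Real.cos _)]
    rw [sum_sin_mul_cos (by lia) (by lia), mul_zero]
  · rw [sum_cos_mul_cos (by lia) (by lia)]
    simp only [Nat.add_right_cancel_iff, Fin.val_inj]
    split_ifs
    · field_simp
    · simp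

lemma sum_mul_fourierWeight {R n : ℕ} (x : Fin n → ℝ) :
    (fun i => ∑ k, x k * fourierWeight R n i k) =
      Sum.elim (fun j : Fin R => sCoeff x (j + 1)) (fun j : Fin R => cCoeff x (j + 1)) := by
  ext i
  rcases i with i | i <;>
  · simp only [fourierWeight, Sum.elim_inl, Sum.elim_inr, sCoeff, cCoeff, sinSum, cosSum,
      Finset.mul_sum]
    exact Finset.sum_congr rfl fun _ _ => mul_left_comm _ _ _

lemma fourierAbs_sq_div {n : ℕ} (x : Fin n → ℝ) (j : ℕ) :
    fourierAbs x j ^ 2 / ((n : ℝ) / 2) = sCoeff x j ^ 2 + cCoeff x j ^ 2 := by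
  rw [fourierAbs, sCoeff, cCoeff, Real.sq_sqrt (by positivity), mul_pow, mul_pow,
    Real.sq_sqrt (by positivity)]
  ring

/-- Convergence in distribution sees only the law of the limit, so the limit variable may be
realised on another space. -/
lemma tendstoInDistribution_of_map_eq {ι E Ω' Ω'' : Type*} {Ω : ι → Type*}
    [∀ i, MeasurableSpace (Ω i)] {μ : (i : ι) → Measure (Ω i)} [∀ i, IsProbabilityMeasure (μ i)]
    [MeasurableSpace Ω'] {μ' : Measure Ω'} [IsProbabilityMeasure μ']
    [MeasurableSpace Ω''] {μ'' : Measure Ω''} [IsProbabilityMeasure μ'']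
    [TopologicalSpace E] [MeasurableSpace E] [OpensMeasurableSpace E]
    {X : (i : ι) → Ω i → E} {Z : Ω' → E} {W : Ω'' → E} {l : Filter ι}
    (h : TendstoInDistribution X l Z μ μ') (hW : AEMeasurable W μ'')
    (hZW : μ'.map Z = μ''.map W) : TendstoInDistribution X l W μ μ'' where
  forall_aemeasurable := h.forall_aemeasurable
  aemeasurable_limit := hW
  tendsto := by
    have he : (⟨μ'.map Z, Measure.isProbabilityMeasure_map h.aemeasurable_limit⟩ :
        ProbabilityMeasure E) = ⟨μ''.map W, Measure.isProbabilityMeasure_map hW⟩ :=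
      Subtype.ext hZW
    exact he ▸ h.tendsto

end DFTTest

theorem proposition1 {Ω : ℕ → Type*} [∀ n, MeasurableSpace (Ω n)]
    (P : (n : ℕ) → Measure (Ω n)) [∀ n, IsProbabilityMeasure (P n)]
    (x : (n : ℕ) → Fin n → Ω n → ℝ)
    (hlaw : ∀ (n : ℕ) (k : Fin n), HasLaw (x n k) DFTTest.uniformSign (P n))
    (hindep : ∀ n : ℕ, iIndepFun (x n) (P n))
    (R : ℕ) :
    -- `(s_1, …, s_R, c_1, …, c_R)` converges in distribution to `2R` independent standard normals
    TendstoInDistribution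
        (fun (n : ℕ) (ω : Ω n) =>
          (Sum.elim (fun j : Fin R => DFTTest.sCoeff (fun k => x n k ω) (j + 1))
            (fun j : Fin R => DFTTest.cCoeff (fun k => x n k ω) (j + 1)) : Fin R ⊕ Fin R → ℝ))
        atTop (fun z : Fin R ⊕ Fin R → ℝ => z) P
        (Measure.pi fun _ : Fin R ⊕ Fin R => gaussianReal 0 1) ∧
    -- `(|f_1|²/m, …, |f_R|²/m)`, `m = n/2`, converges in distribution to `R` independent `χ²₂`
    TendstoInDistribution
        (fun (n : ℕ) (ω : Ω n) (j : Fin R) =>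
          DFTTest.fourierAbs (fun k => x n k ω) (j + 1) ^ 2 / ((n : ℝ) / 2))
        atTop (fun y : Fin R → ℝ => y) P
        (Measure.pi fun _ : Fin R => DFTTest.chiSquared 2) ∧
    -- and this limit law has the stated joint density
    (Measure.pi fun _ : Fin R => DFTTest.chiSquared 2) =
      volume.withDensity (DFTTest.limitDensity R) := by
  have hε : Tendsto (fun n : ℕ => √(2 / (n : ℝ))) atTop (𝓝 0) := by
    simpa using (tendsto_const_div_atTop_nhds_zero_nat (2 : ℝ)).sqrt
  have hclt := DFTTest.tendstoInDistribution_sum_uniformSign hlaw hindep hε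
    (DFTTest.abs_fourierWeight_le R) fun i j =>
      tendsto_const_nhds.congr' <| (eventually_gt_atTop (2 * R)).mono fun n hn =>
        (DFTTest.sum_fourierWeight_mul hn i j).symm
  have hfun : (fun n ω i => ∑ k, x n k ω * DFTTest.fourierWeight R n i k) = fun n ω =>
      Sum.elim (fun j : Fin R => DFTTest.sCoeff (fun k => x n k ω) (j + 1))
        (fun j : Fin R => DFTTest.cCoeff (fun k => x n k ω) (j + 1)) :=
    funext fun n => funext fun ω => DFTTest.sum_mul_fourierWeight fun k => x n k ω
  rw [hfun] at hclt
  refine ⟨hclt, ?_, DFTTest.pi_chiSquared_two_eq_withDensity R⟩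
  have hsq := hclt.continuous_comp
    (g := fun (z : Fin R ⊕ Fin R → ℝ) (j : Fin R) => z (Sum.inl j) ^ 2 + z (Sum.inr j) ^ 2)
    (by fun_prop)
  simp_rw [DFTTest.fourierAbs_sq_div]
  refine DFTTest.tendstoInDistribution_of_map_eq hsq aemeasurable_id' ?_
  rw [Measure.map_id']
  exact DFTTest.map_pi_gaussianReal_eq_pi_chiSquared (Fin R)
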